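/- **Corollary (Jacobi–Trudi-type formulas).** Let $\mathbf y=(y_i)_{i\in\mathbb Z}$, $\mathbf z=(z_i)_{i\in\mathbb Z}$ be families of elements of a commutative ring (e.g. variables), and let $e_k(\mathbf y_{a,b}/\mathbf z_{a',b'})=\sum_{i=0}^k(-1)^{k-i}e_i(y_a,\dots,y_b)\,h_{k-i}(z_{a'},\dots,z_{b'})$ be the elementary supersymmetric functions ($0$ for $k<0$; a set of variables with $a>b$ is empty). An *r-shape* is a skew shape $\lambda/\mu$ together with an integer $r$; its cell $(i,j)$ has content $j-i+r-1+\lambda_1'$, and the usual shape has $r=1-\lambda'_1$, i.e. contents $j-i$. For an r-shape and $N\ge\lambda_1$, *flags* are vectors $\mathbf a,\mathbf b\in\mathbb Z^N$ such that, for every $i$ with $\mu_i'<\lambda_{i+1}'$, $$a_i-a_{i+1}\le \mu_i'-\mu_{i+1}'+1,\qquad b_i-b_{i+1}\le\lambda'_i-\lambda'_{i+1}+1 .$$ For such vectors set $a'_j=a_j+c(\gamma_j)$, $b'_j=b_j+c(\delta_j)$, where $c(\gamma_j),c(\delta_j)$ are the contents of the positions $(\mu'_j+1,j)$ and $(\lambda'_j,j)$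 (the top and bottom cells of column $j$), and $$\mathsf S^{\mathbf a,\mathbf b}_{\lambda/\mu}(\mathbf y/\mathbf z)=\det\left[e_{\lambda_i'-i-\mu_j'+j}(\mathbf y_{a_j,b_i}/\mathbf z_{a'_j,b'_i})\right]_{1\le i,j\le N}.$$ For $k\ge 0$ and $c\in\mathbb Z$ let $h^{\mathbf p,\mathbf q}_{k,c}(\mathbf y/\mathbf z)$ be this determinant, with $N=k$, for the one-row r-shape with $k$ cells and contents $c,c+1,\dots,c+k-1$ (so $h_{0,c}=1$), and put $h_{k,c}=0$ for $k<0$. (1) For all $k\ge0$, $c\in\mathbb Z$ and all flags $\mathbf p,\mathbf q$ for the one-row r-shape $(k,c)$, $$h^{\mathbf p,\mathbf q}_{k,c}(\mathbf y/\mathbf z)=\sum_{\substack{i_1\le\dots\le i_k\\ p_r\le i_r\le q_r}}\ \prod_{r=1}^k\left(y_{i_r}-z_{i_r+c+r-1}\right).$$ (2) Let $\lambda/\mu$ be a usual skew shape, $N\ge\lambda_1$, $n\ge\ell(\lambda)$, and let $\mathbf a,\mathbf b\in\mathbb Z^N$ be flags for $\lambda/\mu$. Then $$\mathsf S^{\mathbf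 a,\mathbf b}_{\lambda/\mu}(\mathbf y/\mathbf z)=\det\left[h^{\mathbf a^{ij},\mathbf b^{ij}}_{\lambda_i-\mu_j-i+j,\ \mu_j+1-j}(\mathbf y/\mathbf z)\right]_{1\le i,j\le n},$$ where $\mathbf a^{ij},\mathbf b^{ij}$ are the induced ribbon flags for the r-shape $(\lambda_i-\mu_j-i+j,\ \mu_j+1-j)$: writing $c_r=\mu_j+1-j+(r-1)$ for the content of its $r$-th cell, and $m_r$, $M_r$ for the leftmost and the rightmost cell of $\lambda/\mu$ of content $c_r$, $$a^{ij}_r=a_{\mathrm{col}(m_r)}-(\mu'_{\mathrm{col}(m_r)}+1)+\mathrm{row}(m_r),\qquad b^{ij}_r=b_{\mathrm{col}(M_r)}-\lambda'_{\mathrm{col}(M_r)}+\mathrm{row}(M_r).$$ If no cell of $\lambda/\mu$ has content $c_r$, then $a^{ij}_r,b^{ij}_r$ may be chosen to be arbitrary integers. (3) In (2), if $\lambda_i-\mu_j-i+j\ge0$ and all the contents $c_r$ occur in $\lambda/\mu$, then $\mathbf a^{ij},\mathbf b^{ij}$ are flags for the one-row r-shape $(\lambda_i-\mu_j-i+j,\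 \mu_j+1-j)$, so that the $(i,j)$ entry has the tableau expansion of (1). -/

import Mathlib

open Finset

/-- The elementary symmetric polynomial `e_k` in the variables `y i`, `i ∈ s`:
the sum over `i_1 < ... < i_k` in `s` of `y i_1 * ... * y i_k`. -/
def elemSym {R : Type*} [CommRing R] (y : ℤ → R) (s : Finset ℤ) (k : ℕ) : R :=
  ∑ t ∈ s.powersetCard k, ∏ i ∈ t, y i

/-- The complete homogeneous symmetric polynomial `h_k` in the variables `y i`, `i ∈ s`:
the sum over multisets `{i_1 ≤ ... ≤ i_k}` in `s` of `y i_1 * ... * y i_k`. -/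
def complSym {R : Type*} [CommRing R] (y : ℤ → R) (s : Finset ℤ) (k : ℕ) : R :=
  ∑ t ∈ s.sym k, ((t : Multiset ℤ).map y).prod

/-- The elementary supersymmetric function
`e_k(y_s / z_t) = ∑_{i=0}^k (-1)^(k-i) e_i(y_s) h_(k-i)(z_t)`, with `e_k = 0` for `k < 0`. -/
def superElem {R : Type*} [CommRing R] (y z : ℤ → R) (s t : Finset ℤ) (k : ℤ) : R :=
  if k < 0 then 0
  else ∑ i ∈ range (k.toNat + 1),
    (-1) ^ (k.toNat - i) * elemSym y s i * complSym z t (k.toNat - i)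

/-- A skew r-shape `(λ/μ, r)`: a skew shape together with a root content `r ∈ ℤ`.
Rows and columns are numbered from `0`, as in Mathlib's `YoungDiagram`; so `λ_{i+1}` is
`outer.rowLen i` and `λ'_{j+1}` is `outer.colLen j`. -/
structure RShape where
  /-- the partition `λ` -/
  outer : YoungDiagram
  /-- the partition `μ` -/
  inner : YoungDiagram
  inner_le : inner ≤ outer
  /-- the root content `r` -/
  root : ℤ

namespace RShape

/-- The usual skew shape `λ/μ`, which is the r-shape with root content `1 - λ'_1`. -/
def usual (lam mu : YoungDiagram) (h : mu ≤ lam) : RShape :=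
  ⟨lam, mu, h, 1 - (lam.colLen 0 : ℤ)⟩

/-- The r-shape `(k, c)`: one row with `k` cells and root content `c`. -/
def row (k : ℕ) (c : ℤ) : RShape :=
  ⟨YoungDiagram.ofRowLens [k] (List.pairwise_singleton _ _).sortedGE, ⊥, bot_le, c⟩

/-- The cells of the diagram of `λ/μ`. -/
def cells (sh : RShape) : Finset (ℕ × ℕ) := sh.outer.cells \ sh.inner.cells

/-- The shifted content `j - i + r - 1 + λ'_1` of the position in row `i` and column `j`. -/
def content (sh : RShape) (i j : ℤ) : ℤ := j - i + sh.root - 1 + (sh.outer.colLen 0 : ℤ)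

/-- `a`, `b` are column flags for the r-shape `λ/μ`. Here a vector of length `N ≥ λ_1` is given by a
sequence of which only the first `N` terms are used; the conditions concern the first `λ_1` only. -/
def IsColumnFlags (sh : RShape) (a b : ℕ → ℤ) : Prop :=
  ∀ i : ℕ, sh.inner.colLen i < sh.outer.colLen (i + 1) →
    a i - a (i + 1) ≤ (sh.inner.colLen i : ℤ) - sh.inner.colLen (i + 1) + 1 ∧
    b i - b (i + 1) ≤ (sh.outer.colLen i : ℤ) - sh.outer.colLen (i + 1) + 1

/-- The conjugate flag `a'_j = a_j + c(γ_j)`, with `γ_j` the top cell of column `j`,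
which lies in row `μ'_j` (rows numbered from `0`). -/
def conjLower (sh : RShape) (a : ℕ → ℤ) (j : ℕ) : ℤ :=
  a j + sh.content (sh.inner.colLen j) j

/-- The conjugate flag `b'_i = b_i + c(δ_i)`, with `δ_i` the bottom cell of column `i`,
which lies in row `λ'_i - 1` (rows numbered from `0`). -/
def conjUpper (sh : RShape) (b : ℕ → ℤ) (i : ℕ) : ℤ :=
  b i + sh.content ((sh.outer.colLen i : ℤ) - 1) i

/-- The flagged supersymmetric Schur function `S^{a,b}_{λ/μ}(y/z)`, as the `N × N` determinant of
`e_{λ'_i - i - μ'_j + j}(y_{a_j,b_i} / z_{a'_j,b'_i})` (to be used with `N ≥ λ_1`). -/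
noncomputable def flaggedSchur {R : Type*} [CommRing R] (sh : RShape) (N : ℕ) (a b : ℕ → ℤ) (y z : ℤ → R) : R :=
  Matrix.det (Matrix.of fun i j : Fin N =>
    superElem y z (Icc (a j) (b i)) (Icc (sh.conjLower a j) (sh.conjUpper b i))
      ((sh.outer.colLen i : ℤ) - (i : ℕ) - sh.inner.colLen j + (j : ℕ)))

/-- `m` is the leftmost cell `min(c)` of content `c` in the diagram. -/
def IsLeftmost (sh : RShape) (c : ℤ) (m : ℕ × ℕ) : Prop :=
  m ∈ sh.cells ∧ sh.content m.1 m.2 = c ∧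
    ∀ x ∈ sh.cells, sh.content x.1 x.2 = c → m.2 ≤ x.2

/-- `M` is the rightmost cell `max(c)` of content `c` in the diagram. -/
def IsRightmost (sh : RShape) (c : ℤ) (M : ℕ × ℕ) : Prop :=
  M ∈ sh.cells ∧ sh.content M.1 M.2 = c ∧
    ∀ x ∈ sh.cells, sh.content x.1 x.2 = c → x.2 ≤ M.2

/-- `A`, `B` are the ribbon flags induced by the flags `a`, `b` of `λ/μ` on a ribbon whose canonical
decomposition `ρ_0 → ... → ρ_{k-1}` into vertical strips is such that the top cell of `ρ_r` has
content `top r` and its bottom cell has content `bot r`. With rows numbered from `1`,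
`A_r = a_{col(m)} - (μ'_{col(m)} + 1) + row(m)` for `m` the leftmost cell of `λ/μ` of content
`top r`, and `B_r = b_{col(M)} - λ'_{col(M)} + row(M)` for `M` the rightmost cell of `λ/μ` of
content `bot r`. Nothing is required at a content that does not occur in `λ/μ`. -/
def IsInducedRibbonFlags (sh : RShape) (a b : ℕ → ℤ) (k : ℕ) (top bot : ℕ → ℤ)
    (A B : ℕ → ℤ) : Prop :=
  ∀ r < k,
    (∀ m, sh.IsLeftmost (top r) m →
      A r = a m.2 - ((sh.inner.colLen m.2 : ℤ) + 1) + ((m.1 : ℤ) + 1)) ∧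
    (∀ M, sh.IsRightmost (bot r) M →
      B r = b M.2 - (sh.outer.colLen M.2 : ℤ) + ((M.1 : ℤ) + 1))

/-- Induced ribbon flags for the one-row r-shape `(k, c)`: its canonical decomposition is into
single cells, the `r`-th of which has content `c + r` (`r = 0, ..., k - 1`). -/
def IsInducedRowFlags (sh : RShape) (a b : ℕ → ℤ) (k : ℕ) (c : ℤ) (A B : ℕ → ℤ) : Prop :=
  sh.IsInducedRibbonFlags a b k (fun r => c + r) (fun r => c + r) A B

end RShape

/-- `h^{p,q}_{k,c}(y/z)`, the flagged supersymmetric Schur function of the r-shape `(k, c)`.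
It is `1` for `k = 0` (empty determinant) and, by convention, `0` for `k < 0`. -/
noncomputable def flaggedComplete {R : Type*} [CommRing R] (k c : ℤ) (p q : ℕ → ℤ) (y z : ℤ → R) : R :=
  if k < 0 then 0 else (RShape.row k.toNat c).flaggedSchur k.toNat p q y z

/-- The sum over integers `i_0 ≤ ... ≤ i_{k-1}` with `p_r ≤ i_r ≤ q_r` of
`∏_{r < k} (y_{i_r} - z_{i_r + c + r})`. -/
noncomputable def rowTableauSum {R : Type*} [CommRing R] (k : ℕ) (c : ℤ) (p q : ℕ → ℤ) (y z : ℤ → R) : R :=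
  open Classical in
  ∑ f ∈ (Fintype.piFinset fun r : Fin k => Icc (p r) (q r)).filter (fun f => Monotone f),
    ∏ r : Fin k, (y (f r) - z (f r + c + (r : ℕ)))

/-! Fix bounds `A`, `B` on integers attached to each content, and give an entry `u` at content `c`
the weight `y u - z (u + c + s)`. Let `rowSum` sum over weakly increasing sequences along an
interval of contents, and `colSum` over strictly decreasing ones. Comparing the last entry of a row
with the first entry of the column that continues it shows that the alternating sum of products row
times column telescopes to zero. This needs nothing of the weights or bounds. Hence the
unitriangular matrices `H` of row sums and `E` of signed column sums, indexed by contents, are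
inverse to each other.

Jacobi's theorem on complementary minors, applied to the boundary steps of `lam` and `mu` as in the
classical duality of the two Jacobi–Trudi determinants, turns a determinant of column sums into one
of row sums (`det_colSumIco_eq_det_rowSumIco`).

It remains to identify entries. The flags `a`, `b` induce bounds at each content that occurs in the
shape, and the flag inequalities say exactly what is needed for these bounds to drop by at most one
from a content to the next (`lowerBoundAt_le`, `upperBoundAt_le`). In a strictly decreasing sequence
the bounds at the two ends then imply all others, and a column sum is a supersymmetric `e_k`
(`colSum_eq_superElem`).

This fails for entries that involve contents absent from the shape, but such entries contribute to
no nonzero term of the determinant (`Matrix.det_congr_of_covered`); the same fact makes the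
arbitrary choices in the induced flags harmless. The tableau expansion of `h` is the case of a
one-row shape, where the row determinant has size one. -/

/-! ### Recursions for elementary supersymmetric functions. -/

section SymmetricFunctions

variable {R : Type*} [CommRing R]

theorem elemSym_zero (y : ℤ → R) (s : Finset ℤ) : elemSym y s 0 = 1 := by
  simp [elemSym]

theorem complSym_zero (z : ℤ → R) (t : Finset ℤ) : complSym z t 0 = 1 := by
  simp only [complSym, sym_zero, sum_singleton]
  rfl

theorem elemSym_eq_zero_of_card_lt (y : ℤ → R) {s : Finset ℤ} {k : ℕ} (h : s.card < k) :
    elemSym y s k = 0 := by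
  simp [elemSym, powersetCard_eq_empty.2 h]

theorem complSym_empty_succ (z : ℤ → R) (k : ℕ) : complSym z ∅ (k + 1) = 0 := by
  simp [complSym]

theorem elemSym_insert_succ (y : ℤ → R) {s : Finset ℤ} {a : ℤ} (ha : a ∉ s) (k : ℕ) :
    elemSym y (insert a s) (k + 1) = elemSym y s (k + 1) + y a * elemSym y s k := by
  unfold elemSym
  rw [powersetCard_succ_insert ha, sum_union, sum_image, mul_sum]
  · congr 1
    refine sum_congr rfl fun t ht => ?_
    rw [prod_insert fun h => ha ((mem_powersetCard.1 ht).1 h)]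
  · intro t ht u hu h
    have h1 : a ∉ t := fun h => ha ((mem_powersetCard.1 ht).1 h)
    have h2 : a ∉ u := fun h => ha ((mem_powersetCard.1 hu).1 h)
    rw [← erase_insert h1, ← erase_insert h2, h]
  · rw [disjoint_left]
    intro t ht hu
    obtain ⟨u, -, rfl⟩ := mem_image.1 hu
    exact ha ((mem_powersetCard.1 ht).1 (mem_insert_self a u))

theorem complSym_insert_succ (z : ℤ → R) {t : Finset ℤ} {b : ℤ} (hb : b ∉ t) (k : ℕ) :
    complSym z (insert b t) (k + 1) = complSym z t (k + 1) + z b * complSym z (insert b t) k := by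
  unfold complSym
  rw [← sum_filter_add_sum_filter_not ((insert b t).sym (k + 1)) (fun m => b ∉ m), mul_sum]
  congr 1
  · refine sum_congr ?_ fun _ _ => rfl
    ext m
    simp only [mem_filter, mem_sym_iff, mem_insert]
    constructor
    · rintro ⟨h1, h2⟩ x hx
      rcases h1 x hx with rfl | h
      · exact absurd hx h2
      · exact h
    · intro h
      exact ⟨fun x hx => Or.inr (h x hx), fun h' => hb (h b h')⟩
  · symm
    refine sum_bij (fun m _ => b ::ₛ m) ?_ ?_ ?_ ?_
    · intro m hm
      rw [mem_sym_iff] at hm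
      simp only [mem_filter, mem_sym_iff, Sym.mem_cons, not_not, true_or, and_true]
      rintro x (rfl | hx)
      · exact mem_insert_self _ _
      · exact hm x hx
    · intro m _ m' _ h
      exact Sym.cons_inj_right b m m' |>.1 h
    · intro m hm
      simp only [mem_filter, mem_sym_iff, not_not] at hm
      obtain ⟨m', rfl⟩ := Sym.exists_cons_of_mem hm.2
      exact ⟨m', mem_sym_iff.2 fun x hx => hm.1 x (Sym.mem_cons_of_mem hx), rfl⟩
    · intro m _
      change z b * _ = (Multiset.map z (b ::ₘ m.1)).prod
      rw [Multiset.map_cons, Multiset.prod_cons]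
      rfl

theorem superElem_natCast_eq_coeff (y z : ℤ → R) (s t : Finset ℤ) (k : ℕ) :
    superElem y z s t k = PowerSeries.coeff k
      (PowerSeries.mk (elemSym y s) * PowerSeries.mk fun i => (-1) ^ i * complSym z t i) := by
  rw [PowerSeries.coeff_mul, Nat.sum_antidiagonal_eq_sum_range_succ_mk, superElem,
    if_neg (by omega), Int.toNat_natCast]
  refine sum_congr rfl fun i _ => ?_
  simp only [PowerSeries.coeff_mk]
  ring

theorem mk_elemSym_insert (y : ℤ → R) {s : Finset ℤ} {a : ℤ} (ha : a ∉ s) :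
    PowerSeries.mk (elemSym y (insert a s)) =
      (1 + PowerSeries.C (y a) * PowerSeries.X) * PowerSeries.mk (elemSym y s) := by
  ext k
  rw [add_mul, one_mul, mul_assoc, map_add, PowerSeries.coeff_C_mul]
  cases k with
  | zero => simp [elemSym_zero]
  | succ k => simp [PowerSeries.coeff_succ_X_mul, elemSym_insert_succ y ha]

theorem mk_complSym_insert (z : ℤ → R) {t : Finset ℤ} {b : ℤ} (hb : b ∉ t) :
    PowerSeries.mk (fun i => (-1) ^ i * complSym z t i) =
      (1 + PowerSeries.C (z b) * PowerSeries.X) *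
        PowerSeries.mk fun i => (-1) ^ i * complSym z (insert b t) i := by
  ext k
  rw [add_mul, one_mul, mul_assoc, map_add, PowerSeries.coeff_C_mul]
  cases k with
  | zero => simp [complSym_zero]
  | succ k =>
    simp only [PowerSeries.coeff_succ_X_mul, complSym_insert_succ z hb, PowerSeries.coeff_mk]
    ring

/-- The generating series of `e_k` is the product of the factors `1 + y_i X` divided by the factors
`1 + z_j X`; the recursion comes from `1 + y_a X = (1 + z_b X) + (y_a - z_b) X`. -/
theorem superElem_insert_insert (y z : ℤ → R) {s t : Finset ℤ} {a b : ℤ} (ha : a ∉ s)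
    (hb : b ∉ t) (k : ℕ) :
    superElem y z (insert a s) (insert b t) (k + 1 : ℕ) =
      superElem y z s t (k + 1 : ℕ) + (y a - z b) * superElem y z s (insert b t) k := by
  simp only [superElem_natCast_eq_coeff]
  rw [mk_elemSym_insert y ha, mk_complSym_insert z hb, ← PowerSeries.coeff_C_mul,
    ← PowerSeries.coeff_succ_X_mul k, ← map_add]
  congr 1
  rw [map_sub]
  ring

theorem superElem_zero (y z : ℤ → R) (s t : Finset ℤ) : superElem y z s t 0 = 1 := by
  simp [superElem, elemSym_zero, complSym_zero]

theorem superElem_of_neg (y z : ℤ → R) (s t : Finset ℤ) {k : ℤ} (hk : k < 0) :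
    superElem y z s t k = 0 :=
  if_pos hk

theorem superElem_empty_right (y z : ℤ → R) {s : Finset ℤ} {k : ℕ} (h : s.card < k) :
    superElem y z s ∅ k = 0 := by
  rw [superElem, if_neg (by omega), Int.toNat_natCast]
  refine sum_eq_zero fun i hi => ?_
  rcases (Nat.lt_succ_iff.1 (mem_range.1 hi)).eq_or_lt with rfl | hlt
  · simp [elemSym_eq_zero_of_card_lt y h]
  · obtain ⟨m, hm⟩ := Nat.exists_eq_add_of_lt hlt
    rw [show k - i = m + 1 by omega, complSym_empty_succ, mul_zero]

/-- For `k - 1` more variables `y` than variables `z`, the function `e_k` is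
obtained by adding the pairs of last variables one by one. -/
theorem superElem_Icc_eq_sum (y z : ℤ → R) (a d : ℤ) (m : ℕ) {v : ℤ} (hv : a ≤ v) :
    superElem y z (Icc a (v - 1)) (Icc (a + d + m) (v - 1 + d)) (m + 1 : ℕ) =
      ∑ u ∈ Ico a v, (y u - z (u + d)) *
        superElem y z (Icc a (u - 1)) (Icc (a + d + m) (u + d)) m := by
  induction v, hv using Int.leInduction with
  | base =>
    rw [Ico_self, sum_empty, Icc_eq_empty (a := a + d + m) (by omega), superElem_empty_right]
    rw [Int.card_Icc]
    omega
  | succ v hv ih =>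
    have hI : Ico a (v + 1) = insert v (Ico a v) := by ext; simp; omega
    rw [hI, sum_insert (by simp), ← ih]
    have hy : Icc a (v + 1 - 1) = insert v (Icc a (v - 1)) := by ext; simp; omega
    -- The range of `z` gains the index `v + d` only once `v` reaches `a + m`. Before that all three
    -- ranges of `z` are empty and there are too few variables `y`, so every term vanishes.
    by_cases h : a + m ≤ v
    · have hz : Icc (a + d + m) (v + d) = insert (v + d) (Icc (a + d + m) (v - 1 + d)) := by
        ext; simp; omega
      rw [hy, show v + 1 - 1 + d = v + d by ring, hz,
        superElem_insert_insert y z (by simp) (by simp), add_comm]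
    · rw [Icc_eq_empty (a := a + d + m) (b := v + 1 - 1 + d) (by omega),
        Icc_eq_empty (a := a + d + m) (b := v + d) (by omega),
        Icc_eq_empty (a := a + d + m) (b := v - 1 + d) (by omega),
        superElem_empty_right y z, superElem_empty_right y z, superElem_empty_right y z]
      · simp
      all_goals rw [Int.card_Icc]; omega

end SymmetricFunctions

/-! ### Weighted row and column sums, and their alternating convolution. -/

section PathSums

variable {R : Type*} [CommRing R] (w : ℤ → ℤ → R) (A B : ℤ → ℤ)

/-- The sum over sequences `f_0 ≤ ... ≤ f_{m-1} ≤ v` with `A (c + r) ≤ f_r ≤ B (c + r)` of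
`∏ w (c + r) f_r`. -/
noncomputable def rowSumLE (c : ℤ) : ℕ → ℤ → R
  | 0, _ => 1
  | m + 1, v => ∑ u ∈ (Icc (A (c + m)) (B (c + m))).filter (· ≤ v), w (c + m) u * rowSumLE c m u

/-- The sum over sequences `f_0 ≤ ... ≤ f_{m-1}` with `A (c + r) ≤ f_r ≤ B (c + r)` of
`∏ w (c + r) f_r`. -/
noncomputable def rowSum (c : ℤ) : ℕ → R
  | 0 => 1
  | m + 1 => ∑ u ∈ Icc (A (c + m)) (B (c + m)), w (c + m) u * rowSumLE w A B c m u

/-- The sum over sequences `v > f_0 > ... > f_{m-1}` with `A (d + r) ≤ f_r ≤ B (d + r)` of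
`∏ w (d + r) f_r`. -/
noncomputable def colSumLT : ℕ → ℤ → ℤ → R
  | 0, _, _ => 1
  | m + 1, d, v => ∑ u ∈ (Icc (A d) (B d)).filter (· < v), w d u * colSumLT m (d + 1) u

/-- The sum over sequences `f_0 > ... > f_{m-1}` with `A (d + r) ≤ f_r ≤ B (d + r)` of
`∏ w (d + r) f_r`. -/
noncomputable def colSum : ℕ → ℤ → R
  | 0, _ => 1
  | m + 1, d => ∑ u ∈ Icc (A d) (B d), w d u * colSumLT w A B m (d + 1) u

/-- The sum over sequences `f_0 ≤ ... ≤ f_m > ... > f_{m+l}` within the bounds. -/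
noncomputable def hookSum (c : ℤ) (m l : ℕ) : R :=
  ∑ v ∈ Icc (A (c + m)) (B (c + m)),
    rowSumLE w A B c m v * (w (c + m) v * colSumLT w A B l (c + m + 1) v)

/-- Let `u` be the last entry of the row and `v` the first entry of the column. If `v < u`, then `u`
heads the column of a hook; if `u ≤ v`, then `v` extends its row. -/
theorem rowSum_mul_colSum (c : ℤ) (m l : ℕ) :
    rowSum w A B c (m + 1) * colSum w A B (l + 1) (c + (m + 1 : ℕ)) =
      hookSum w A B c m (l + 1) + hookSum w A B c (m + 1) l := by
  have h1 : c + ((m + 1 : ℕ) : ℤ) = c + m + 1 := by push_cast; ring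
  simp only [rowSum, colSum, hookSum, colSumLT, rowSumLE, h1, sum_filter]
  rw [sum_mul_sum]
  simp only [mul_sum, sum_mul]
  rw [sum_comm (s := Icc (A (c + m + 1)) (B (c + m + 1))), ← sum_add_distrib]
  refine sum_congr rfl fun u _ => ?_
  rw [← sum_add_distrib]
  refine sum_congr rfl fun v _ => ?_
  rcases lt_or_ge v u with h | h
  · rw [if_pos h, if_neg (not_le.2 h)]
    ring
  · rw [if_neg (not_lt.2 h), if_pos h]
    ring

/-- Each product with both factors nonempty is a sum of two consecutive hook sums, so the inner
terms telescope; the two extreme terms are themselves hook sums and cancel what is left. -/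
theorem alternating_sum_rowSum_mul_colSum (c : ℤ) (k : ℕ) :
    ∑ m ∈ range (k + 2),
      (-1) ^ m * (rowSum w A B c m * colSum w A B (k + 1 - m) (c + m)) = 0 := by
  rw [sum_range_succ, sum_range_succ']
  have h (m : ℕ) (hm : m ∈ range k) : (-1 : R) ^ (m + 1) * (rowSum w A B c (m + 1) *
      colSum w A B (k + 1 - (m + 1)) (c + (m + 1 : ℕ))) =
      (-1) ^ (m + 1) * hookSum w A B c (m + 1) (k - (m + 1)) -
        (-1) ^ m * hookSum w A B c m (k - m) := by
    have hm := mem_range.1 hm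
    obtain ⟨l, rfl⟩ := Nat.exists_eq_add_of_lt hm
    rw [show m + l + 1 + 1 - (m + 1) = l + 1 by omega, rowSum_mul_colSum,
      show m + l + 1 - (m + 1) = l by omega, show m + l + 1 - m = l + 1 by omega]
    ring
  rw [sum_congr rfl h, sum_range_sub fun m => (-1 : R) ^ m * hookSum w A B c m (k - m)]
  simp [rowSum, colSum, hookSum, rowSumLE, colSumLT]
  ring_nf
  simp only [mul_comm, sub_self]

theorem Fin.monotone_iff_castSucc {m : ℕ} (f : Fin (m + 1) → ℤ) :
    Monotone f ↔ Monotone (fun r : Fin m => f r.castSucc) ∧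
      ∀ r : Fin m, f r.castSucc ≤ f (Fin.last m) := by
  constructor
  · intro h
    exact ⟨fun r s hrs => h (Fin.castSucc_le_castSucc_iff.2 hrs), fun r => h (Fin.le_last _)⟩
  · rintro ⟨h1, h2⟩ r s hrs
    induction s using Fin.lastCases with
    | last =>
      induction r using Fin.lastCases with
      | last => exact le_rfl
      | cast r => exact h2 r
    | cast s =>
      induction r using Fin.lastCases with
      | last => exact absurd hrs (not_le.2 (Fin.castSucc_lt_last s))
      | cast r => exact h1 (Fin.castSucc_le_castSucc_iff.1 hrs)

-- Peels off the last entry. The predicate `q` serves both recursions: it is `· ≤ v` for `rowSumLE`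
-- and trivial for `rowSum`.
open Classical in
theorem sum_monotone_succ (c : ℤ) (m : ℕ) (q : ℤ → Prop) :
    ∑ f ∈ (Fintype.piFinset fun r : Fin (m + 1) =>
        Icc (A (c + (r : ℕ))) (B (c + (r : ℕ)))).filter
      (fun f => Monotone f ∧ q (f (Fin.last m))), ∏ r : Fin (m + 1), w (c + (r : ℕ)) (f r) =
    ∑ u ∈ (Icc (A (c + m)) (B (c + m))).filter q, w (c + m) u *
      ∑ f ∈ (Fintype.piFinset fun r : Fin m => Icc (A (c + (r : ℕ))) (B (c + (r : ℕ)))).filter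
        (fun f => Monotone f ∧ ∀ r, f r ≤ u), ∏ r : Fin m, w (c + (r : ℕ)) (f r) := by
  simp only [mul_sum]
  rw [sum_sigma']
  refine sum_bij' (fun f _ => ⟨f (Fin.last m), fun r : Fin m => f r.castSucc⟩)
    (fun p _ => Fin.snoc (α := fun _ => ℤ) p.2 p.1) ?_ ?_ ?_ ?_ ?_
  · intro f hf
    simp only [mem_filter, Fintype.mem_piFinset, Fin.monotone_iff_castSucc f] at hf
    simp only [mem_sigma, mem_filter, Fintype.mem_piFinset]
    exact ⟨⟨by simpa using hf.1 (Fin.last m), hf.2.2⟩, fun r => by simpa using hf.1 r.castSucc,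
      hf.2.1⟩
  · rintro ⟨u, f⟩ h
    simp only [mem_sigma, mem_filter, Fintype.mem_piFinset] at h
    simp only [mem_filter, Fintype.mem_piFinset, Fin.monotone_iff_castSucc, Fin.snoc_castSucc,
      Fin.snoc_last]
    refine ⟨fun r => ?_, h.2.2, h.1.2⟩
    induction r using Fin.lastCases with
    | last => simpa using h.1.1
    | cast r => simpa using h.2.1 r
  · intro f _
    funext r
    induction r using Fin.lastCases <;> simp
  · rintro ⟨u, f⟩ _
    simp
  · intro f _
    rw [Fin.prod_univ_castSucc, mul_comm]
    simp

open Classical in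
theorem sum_monotone_le_eq_rowSumLE (c : ℤ) (m : ℕ) (v : ℤ) :
    ∑ f ∈ (Fintype.piFinset fun r : Fin m => Icc (A (c + (r : ℕ))) (B (c + (r : ℕ)))).filter
      (fun f => Monotone f ∧ ∀ r, f r ≤ v), ∏ r : Fin m, w (c + (r : ℕ)) (f r) =
      rowSumLE w A B c m v := by
  induction m generalizing v with
  | zero => simp [rowSumLE, Subsingleton.monotone]
  | succ m ih =>
    simp only [rowSumLE, ← ih]
    refine (sum_congr ?_ fun _ _ => rfl).trans
      ((sum_monotone_succ w A B c m (· ≤ v)).trans (sum_congr ?_ fun _ _ => rfl))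
    · ext f
      simp only [mem_filter]
      refine and_congr_right fun _ => and_congr_right fun hf => ?_
      exact ⟨fun h => h _, fun h r => (hf (Fin.le_last r)).trans h⟩
    · ext u
      simp only [mem_filter]

open Classical in
theorem sum_monotone_eq_rowSum (c : ℤ) (m : ℕ) :
    ∑ f ∈ (Fintype.piFinset fun r : Fin m => Icc (A (c + (r : ℕ))) (B (c + (r : ℕ)))).filter
      (fun f => Monotone f), ∏ r : Fin m, w (c + (r : ℕ)) (f r) = rowSum w A B c m := by
  cases m with
  | zero => simp [rowSum, Subsingleton.monotone]
  | succ m =>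
    simp only [rowSum, ← sum_monotone_le_eq_rowSumLE]
    simpa using sum_monotone_succ w A B c m fun _ => True

end PathSums

/-! ### Column sums as supersymmetric functions. -/

section FlaggedColumns

variable {R : Type*} [CommRing R] (y z : ℤ → R) (A B : ℤ → ℤ) (s : ℤ)

/-- If the bounds decrease by at most one from each content to the next, then they are
implied along a column by the bounds at its ends. -/
theorem colSumLT_eq_superElem (m : ℕ) (d : ℤ)
    (hA : ∀ r < m, A (d + r) ≤ A (d + r + 1) + 1) (hB : ∀ r < m, B (d + r) ≤ B (d + r + 1) + 1)
    {v : ℤ} (hv : v ≤ B d + 1) :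
    colSumLT (fun c u => y u - z (u + (c + s))) A B (m + 1) d v =
      superElem y z (Icc (A (d + m)) (v - 1)) (Icc (A (d + m) + (d + s) + m) (v - 1 + (d + s)))
        (m + 1 : ℕ) := by
  induction m generalizing d v with
  | zero =>
    by_cases hvA : A d ≤ v
    · have := superElem_Icc_eq_sum y z (A d) (d + s) 0 hvA
      simp only [Nat.cast_zero, add_zero] at this ⊢
      rw [this, colSumLT]
      refine sum_congr ?_ fun u _ => ?_
      · ext u; simp; omega
      · simp [colSumLT, superElem_zero]
    · rw [colSumLT, filter_eq_empty_iff.2, sum_empty, Icc_eq_empty (by simp; omega),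
        Icc_eq_empty (by simp; omega), superElem_empty_right]
      · simp
      · intro u hu
        simp at hu ⊢
        omega
  | succ m ih =>
    have ih' (u : ℤ) (hu : u ≤ B (d + 1) + 1) := ih (d + 1)
      (fun r hr => by
        have := hA (r + 1) (by omega); push_cast at this; rwa [add_assoc d, add_comm 1 (r : ℤ)])
      (fun r hr => by
        have := hB (r + 1) (by omega); push_cast at this; rwa [add_assoc d, add_comm 1 (r : ℤ)]) hu
    -- The lower bound at `d` is implied by the one at the last content, since `m + 1` strict
    -- descents separate the two entries.
    have hA' : A d ≤ A (d + (m + 1 : ℕ)) + (m + 1 : ℕ) := by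
      have (r : ℕ) (hr : r ≤ m + 1) : A d ≤ A (d + r) + r := by
        induction r with
        | zero => simp
        | succ r ih =>
          have h1 := ih (by omega)
          have h2 := hA r (by omega)
          push_cast
          rw [← add_assoc d]
          omega
      exact this _ le_rfl
    have hB0 := hB 0 (by omega)
    simp only [Nat.cast_zero, add_zero] at hB0
    set a := A (d + (m + 1 : ℕ)) with ha
    rw [colSumLT]
    have h1 : ∀ u ∈ (Icc (A d) (B d)).filter (· < v),
        (y u - z (u + (d + s))) * colSumLT (fun c u => y u - z (u + (c + s))) A B (m + 1) (d + 1) u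
        = (y u - z (u + (d + s))) * superElem y z (Icc a (u - 1))
          (Icc (a + (d + s) + (m + 1 : ℕ)) (u + (d + s))) (m + 1 : ℕ) := by
      intro u hu
      simp only [mem_filter, mem_Icc] at hu
      rw [ih' u (by omega), ha]
      push_cast
      ring_nf
    rw [sum_congr rfl h1]
    -- Below `a + (m + 1)` there is no room for the `m + 1` smaller entries. Hence both sums, over
    -- `u ≥ A d` and over `u ≥ a`, reduce to `u ≥ a + (m + 1)`.
    have h0 (u : ℤ) (hu : u < a + (m + 1 : ℕ)) : superElem y z (Icc a (u - 1))
        (Icc (a + (d + s) + (m + 1 : ℕ)) (u + (d + s))) (m + 1 : ℕ) = 0 := by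
      rw [Icc_eq_empty (a := a + (d + s) + (m + 1 : ℕ)) (by omega), superElem_empty_right]
      rw [Int.card_Icc]
      omega
    by_cases hva : a ≤ v
    · rw [superElem_Icc_eq_sum y z a (d + s) (m + 1) hva,
        ← sum_subset (s₁ := Ico (a + (m + 1 : ℕ)) v) (s₂ := Ico a v),
        ← sum_subset (s₁ := Ico (a + (m + 1 : ℕ)) v)]
      · intro u hu
        simp only [mem_filter, mem_Icc, mem_Ico] at hu ⊢
        omega
      · intro u hu hu'
        simp only [mem_filter, mem_Icc, mem_Ico] at hu hu'
        rw [h0 u (by omega), mul_zero]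
      · exact Ico_subset_Ico_left (by omega)
      · intro u hu hu'
        simp only [mem_Ico] at hu hu'
        rw [h0 u (by omega), mul_zero]
    · rw [sum_eq_zero, Icc_eq_empty (a := a) (by omega), Icc_eq_empty (by omega),
        superElem_empty_right]
      · simp
      · intro u hu
        simp only [mem_filter, mem_Icc] at hu
        rw [h0 u (by omega), mul_zero]

/-- This is the case `v = B d + 1`, in which the condition `u < v` on the first entry is void. -/
theorem colSum_eq_superElem (m : ℕ) (d : ℤ)
    (hA : ∀ r < m, A (d + r) ≤ A (d + r + 1) + 1) (hB : ∀ r < m, B (d + r) ≤ B (d + r + 1) + 1) :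
    colSum (fun c u => y u - z (u + (c + s))) A B (m + 1) d =
      superElem y z (Icc (A (d + m)) (B d)) (Icc (A (d + m) + (d + s) + m) (B d + (d + s)))
        (m + 1 : ℕ) := by
  have := colSumLT_eq_superElem y z A B s m d hA hB le_rfl
  rw [add_sub_cancel_right] at this
  rw [← this, colSum, colSumLT]
  refine sum_congr ?_ fun _ _ => rfl
  ext u
  simp

end FlaggedColumns

/-! ### Jacobi's theorem on complementary minors. -/

section ComplementaryMinors

variable {R : Type*} [CommRing R]

/-- Jacobi's theorem: complementary minors of a matrix and of its inverse. -/
theorem Matrix.det_toBlocks₁₁_of_mul_eq_one {m n : Type*} [Fintype m] [Fintype n] [DecidableEq m]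
    [DecidableEq n] {M M' : Matrix (m ⊕ n) (m ⊕ n) R} (h : M * M' = 1) :
    M.toBlocks₁₁.det = M.det * M'.toBlocks₂₂.det := by
  -- The second block column of `M * M' = 1` gives the second block column here; taking determinants
  -- of both block triangular matrices finishes.
  have hM : M * Matrix.fromBlocks 1 M'.toBlocks₁₂ 0 M'.toBlocks₂₂ =
      Matrix.fromBlocks M.toBlocks₁₁ 0 M.toBlocks₂₁ 1 := by
    have h' := h
    rw [← Matrix.fromBlocks_toBlocks M, ← Matrix.fromBlocks_toBlocks M',
      Matrix.fromBlocks_multiply, ← Matrix.fromBlocks_one, Matrix.fromBlocks_inj] at h'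
    conv_lhs => rw [← Matrix.fromBlocks_toBlocks M]
    rw [Matrix.fromBlocks_multiply, h'.2.1, h'.2.2.2]
    simp
  have := congrArg Matrix.det hM
  rw [Matrix.det_mul, Matrix.det_fromBlocks_zero₂₁, Matrix.det_fromBlocks_zero₁₂] at this
  simpa using this.symm

theorem Matrix.det_submatrix_eq_of_mul_eq_one {n N : ℕ}
    {M M' : Matrix (Fin (n + N)) (Fin (n + N)) R} (h : M * M' = 1) (hM : M.det = 1)
    (σ τ : Equiv.Perm (Fin (n + N))) :
    (M.submatrix (σ ∘ Fin.castAdd N) (τ ∘ Fin.castAdd N)).det =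
      ((σ.sign * τ.sign : ℤˣ) : ℤ) *
        (M'.submatrix (τ ∘ Fin.natAdd n) (σ ∘ Fin.natAdd n)).det := by
  let e : Fin n ⊕ Fin N ≃ Fin (n + N) := finSumFinEquiv
  have h1 : M.submatrix (σ ∘ e) (τ ∘ e) * M'.submatrix (τ ∘ e) (σ ∘ e) = 1 := by
    rw [Matrix.submatrix_mul M M' _ _ _ (τ.bijective.comp e.bijective) |>.symm, h]
    exact Matrix.submatrix_one_equiv (e.trans σ)
  have h2 : (M.submatrix (σ ∘ e) (τ ∘ e)).det = ((σ.sign * τ.sign : ℤˣ) : ℤ) := by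
    have : M.submatrix (σ ∘ e) (τ ∘ e) = ((M.submatrix σ id).submatrix id τ).submatrix e e := rfl
    rw [this, Matrix.det_submatrix_equiv_self, Matrix.det_permute', Matrix.det_permute, hM]
    push_cast
    ring
  have := Matrix.det_toBlocks₁₁_of_mul_eq_one h1
  rw [h2] at this
  exact this

end ComplementaryMinors

/-! ### The boundary permutation of a partition and its sign. -/

section Boundary

variable (lam : YoungDiagram) (n N : ℕ)

/-- The numbering of the boundary steps of a Young diagram in an `n × N` rectangle: the steps
belonging to the rows, and then those belonging to the columns. -/
def boundaryStep (hn : lam.colLen 0 ≤ n) (hN : lam.rowLen 0 ≤ N) : Fin (n + N) → Fin (n + N) :=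
  Fin.addCases
    (fun i => ⟨n - 1 - i + lam.rowLen i, by
      have := lam.rowLen_anti 0 i (Nat.zero_le _)
      omega⟩)
    (fun j => ⟨n + j - lam.colLen j, by omega⟩)

variable {lam n N} (hn : lam.colLen 0 ≤ n) (hN : lam.rowLen 0 ≤ N)

theorem boundaryStep_castAdd (i : Fin n) :
    (boundaryStep lam n N hn hN (Fin.castAdd N i) : ℕ) = n - 1 - i + lam.rowLen i := by
  simp [boundaryStep]

theorem boundaryStep_natAdd (j : Fin N) :
    (boundaryStep lam n N hn hN (Fin.natAdd n j) : ℕ) = n + j - lam.colLen j := by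
  simp [boundaryStep]

theorem boundaryStep_castAdd_lt_castAdd {i j : Fin n} (h : i < j) :
    boundaryStep lam n N hn hN (Fin.castAdd N j) < boundaryStep lam n N hn hN (Fin.castAdd N i) := by
  rw [Fin.lt_def, boundaryStep_castAdd, boundaryStep_castAdd]
  have := lam.rowLen_anti i j h.le
  omega

theorem boundaryStep_natAdd_lt_natAdd {i j : Fin N} (h : i < j) :
    boundaryStep lam n N hn hN (Fin.natAdd n i) < boundaryStep lam n N hn hN (Fin.natAdd n j) := by
  rw [Fin.lt_def, boundaryStep_natAdd, boundaryStep_natAdd]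
  have := lam.colLen_anti i j h.le
  have := lam.colLen_anti 0 i (Nat.zero_le _)
  omega

theorem boundaryStep_castAdd_lt_natAdd_of_le {i : Fin n} {j : Fin N} (h : lam.colLen j ≤ i) :
    boundaryStep lam n N hn hN (Fin.castAdd N i) < boundaryStep lam n N hn hN (Fin.natAdd n j) := by
  rw [Fin.lt_def, boundaryStep_castAdd, boundaryStep_natAdd]
  have h1 : ¬ (j : ℕ) < lam.rowLen i := by
    rw [← YoungDiagram.mem_iff_lt_rowLen, YoungDiagram.mem_iff_lt_colLen]
    omega
  omega

theorem boundaryStep_natAdd_lt_castAdd_of_lt {i : Fin n} {j : Fin N} (h : (i : ℕ) < lam.colLen j) :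
    boundaryStep lam n N hn hN (Fin.natAdd n j) < boundaryStep lam n N hn hN (Fin.castAdd N i) := by
  rw [Fin.lt_def, boundaryStep_castAdd, boundaryStep_natAdd]
  have h1 : (j : ℕ) < lam.rowLen i := by
    rw [← YoungDiagram.mem_iff_lt_rowLen, YoungDiagram.mem_iff_lt_colLen]
    omega
  omega

theorem boundaryStep_injective : Function.Injective (boundaryStep lam n N hn hN) := by
  suffices h : ∀ a b, a < b → boundaryStep lam n N hn hN a ≠ boundaryStep lam n N hn hN b from
    fun a b hab => by_contra fun hne => (lt_or_gt_of_ne hne).elim (fun h' => h a b h' hab)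
      fun h' => h b a h' hab.symm
  intro a b hab
  induction b using Fin.addCases with
  | left j =>
    induction a using Fin.addCases with
    | left i => exact (boundaryStep_castAdd_lt_castAdd hn hN hab).ne'
    | right i =>
      rw [Fin.lt_def, Fin.val_natAdd, Fin.val_castAdd] at hab
      omega
  | right j =>
    induction a using Fin.addCases with
    | left i =>
      rcases lt_or_ge (i : ℕ) (lam.colLen j) with h | h
      · exact (boundaryStep_natAdd_lt_castAdd_of_lt hn hN h).ne'
      · exact (boundaryStep_castAdd_lt_natAdd_of_le hn hN h).ne
    | right i => exact (boundaryStep_natAdd_lt_natAdd hn hN (by simpa using hab)).ne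

/-- The permutation given by `boundaryStep`. -/
noncomputable def boundaryPerm : Equiv.Perm (Fin (n + N)) :=
  Equiv.ofBijective _ (Finite.injective_iff_bijective.1 (boundaryStep_injective hn hN))

theorem boundaryPerm_apply (a : Fin (n + N)) :
    boundaryPerm hn hN a = boundaryStep lam n N hn hN a := rfl

/-- Counts inversions: all pairs of rows are inverted, no pair of columns is, and row `i` is
inverted with column `j` exactly when `(i, j)` is a cell. -/
theorem sign_boundaryPerm : (boundaryPerm hn hN).sign =
    (∏ j : Fin n, ∏ _i ∈ Iio (Fin.castAdd N j), (-1 : ℤˣ)) *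
      ∏ j : Fin N, (-1) ^ lam.colLen j := by
  rw [Equiv.Perm.sign_eq_prod_prod_Iio, Fin.prod_univ_add]
  congr 1
  · refine prod_congr rfl fun j _ => prod_congr rfl fun i hi => ?_
    rw [mem_Iio] at hi
    induction i using Fin.addCases with
    | left i =>
      exact if_neg (boundaryStep_castAdd_lt_castAdd hn hN hi).not_gt
    | right i =>
      rw [Fin.lt_def, Fin.val_natAdd, Fin.val_castAdd] at hi
      omega
  · refine prod_congr rfl fun j _ => ?_
    rw [← prod_ite_mem_eq, Fin.prod_univ_add]
    have h1 (i : Fin N) : (if Fin.natAdd n i ∈ Iio (Fin.natAdd n j) then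
        (if boundaryPerm hn hN (Fin.natAdd n i) < boundaryPerm hn hN (Fin.natAdd n j)
          then (1 : ℤˣ) else -1) else 1) = 1 := by
      split_ifs with h h'
      · rfl
      · exact absurd (boundaryStep_natAdd_lt_natAdd hn hN (by simpa using h)) h'
      · rfl
    have h2 (i : Fin n) : (if Fin.castAdd N i ∈ Iio (Fin.natAdd n j) then
        (if boundaryPerm hn hN (Fin.castAdd N i) < boundaryPerm hn hN (Fin.natAdd n j)
          then (1 : ℤˣ) else -1) else 1) = if (i : ℕ) < lam.colLen j then -1 else 1 := by
      rw [if_pos (by rw [mem_Iio, Fin.lt_def, Fin.val_natAdd, Fin.val_castAdd]; omega)]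
      rcases lt_or_ge (i : ℕ) (lam.colLen j) with h | h
      · rw [if_pos h]
        exact if_neg (boundaryStep_natAdd_lt_castAdd_of_lt hn hN h).not_gt
      · rw [if_neg h.not_gt]
        exact if_pos (boundaryStep_castAdd_lt_natAdd_of_le hn hN h)
    rw [prod_congr rfl fun i _ => h1 i, prod_congr rfl fun i _ => h2 i, prod_const_one, mul_one,
      prod_ite, prod_const_one, mul_one, prod_const, Fin.card_filter_val_lt]
    have := lam.colLen_anti 0 j (Nat.zero_le _)
    rw [min_eq_right (by omega)]

/-- The right-hand side does not depend on `lam`, so the signs for two partitions in the same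
rectangle cancel. -/
theorem sign_boundaryPerm_mul_prod : (boundaryPerm hn hN).sign *
    ∏ j : Fin N, (-1) ^ (boundaryPerm hn hN (Fin.natAdd n j) : ℕ) =
    (∏ j : Fin n, ∏ _i ∈ Iio (Fin.castAdd N j), (-1 : ℤˣ)) * ∏ j : Fin N, (-1) ^ (n + j : ℕ) := by
  rw [sign_boundaryPerm, mul_assoc, ← prod_mul_distrib]
  congr 1
  refine prod_congr rfl fun j _ => ?_
  rw [← pow_add, boundaryPerm_apply, boundaryStep_natAdd]
  have := lam.colLen_anti 0 j (Nat.zero_le _)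
  rw [Nat.add_sub_cancel' (by omega)]

end Boundary

/-! ### Duality between determinants of row sums and of column sums. -/

section DualDeterminants

variable {R : Type*} [CommRing R] (w : ℤ → ℤ → R) (A B : ℤ → ℤ)

/-- `rowSum` over the contents `c, ..., d - 1`; it is `0` for `d < c`. -/
noncomputable def rowSumIco (c d : ℤ) : R := if d < c then 0 else rowSum w A B c (d - c).toNat

/-- `colSum` over the contents `c, ..., d - 1`; it is `0` for `d < c`. -/
noncomputable def colSumIco (c d : ℤ) : R := if d < c then 0 else colSum w A B (d - c).toNat c

theorem rowSumIco_self (c : ℤ) : rowSumIco w A B c c = 1 := by simp [rowSumIco, rowSum]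

theorem colSumIco_self (c : ℤ) : colSumIco w A B c c = 1 := by simp [colSumIco, colSum]

/-- The entry `(p, q)` of `H * E = 1`: only `p ≤ m ≤ q` contributes, and for `p < q` this is the
alternating sum up to the sign `(-1) ^ (p + q)`. -/
theorem rowSumIco_mul_colSumIco_sum (s : ℤ) (K : ℕ) (p q : Fin K) :
    ∑ m : Fin K, rowSumIco w A B (p + s) (m + s) *
      ((-1) ^ (m + q : ℕ) * colSumIco w A B (m + s) (q + s)) = if p = q then 1 else 0 := by
  have hz (m : Fin K) (hm : m < p ∨ q < m) : rowSumIco w A B (p + s) (m + s) *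
      ((-1) ^ (m + q : ℕ) * colSumIco w A B (m + s) (q + s)) = 0 := by
    simp only [rowSumIco, colSumIco]
    rcases hm with h | h
    · rw [if_pos (by have := Fin.lt_def.1 h; omega), zero_mul]
    · rw [if_pos (c := (q : ℤ) + s < m + s) (by have := Fin.lt_def.1 h; omega), mul_zero, mul_zero]
  rcases lt_trichotomy p q with h | rfl | h
  · rw [if_neg h.ne]
    obtain ⟨k, hk⟩ := Nat.exists_eq_add_of_lt (Fin.lt_def.1 h)
    have := alternating_sum_rowSum_mul_colSum w A B (p + s) k
    rw [← sum_subset (subset_univ (Icc p q)) fun m _ hm => hz m (by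
      rw [mem_Icc, not_and_or, not_le, not_le] at hm; exact hm)]
    have h' := congrArg (fun x => (-1 : R) ^ (p + q : ℕ) * x) this
    simp only [mul_zero, mul_sum] at h'
    rw [← h']
    refine sum_bij' (fun m _ => (m : ℕ) - p) (fun m hm => ⟨p + m, by
      have := mem_range.1 hm; omega⟩) ?_ ?_ ?_ ?_ ?_
    · intro m hm
      rw [mem_Icc, Fin.le_def, Fin.le_def] at hm
      rw [mem_range]
      omega
    · intro m hm
      rw [mem_range] at hm
      rw [mem_Icc, Fin.le_def, Fin.le_def]
      dsimp only
      omega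
    · intro m hm
      rw [mem_Icc, Fin.le_def, Fin.le_def] at hm
      ext
      dsimp only
      omega
    · intro m hm
      dsimp only
      omega
    · intro m hm
      rw [mem_Icc, Fin.le_def, Fin.le_def] at hm
      obtain ⟨l, hl⟩ := Nat.exists_eq_add_of_le hm.1
      rw [rowSumIco, colSumIco, if_neg (by omega), if_neg (by omega), hl, Nat.add_sub_cancel_left,
        show ((p + l : ℕ) + s - (p + s) : ℤ).toNat = l by omega,
        show ((q : ℤ) + s - ((p + l : ℕ) + s)).toNat = k + 1 - l by omega,
        show (p : ℤ) + s + l = (p + l : ℕ) + s by push_cast; ring]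
      ring
  · rw [if_pos rfl, sum_eq_single p]
    · rw [rowSumIco_self, colSumIco_self, ← two_mul, pow_mul]
      simp
    · intro m _ hm
      exact hz m (lt_or_gt_of_ne hm)
    · simp
  · rw [if_neg h.ne']
    refine sum_eq_zero fun m _ => hz m ?_
    rcases lt_or_ge m p with h' | h'
    · exact Or.inl h'
    · exact Or.inr (h.trans_le h')

/-- The duality of determinants of row and column sums in a skew shape. -/
theorem det_colSumIco_eq_det_rowSumIco {lam mu : YoungDiagram} (hmu : mu ≤ lam) {n N : ℕ}
    (hn : lam.colLen 0 ≤ n) (hN : lam.rowLen 0 ≤ N) :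
    (Matrix.of fun i j : Fin N => colSumIco w A B ((i : ℕ) + 1 - lam.colLen i)
      ((j : ℕ) + 1 - mu.colLen j)).det =
    (Matrix.of fun i j : Fin n => rowSumIco w A B (mu.rowLen j - (j : ℕ))
      (lam.rowLen i - (i : ℕ))).det := by
  have hn' : mu.colLen 0 ≤ n := le_trans (by
    by_contra! h
    have := hmu (YoungDiagram.mem_iff_lt_colLen.2 h)
    exact (YoungDiagram.mem_iff_lt_colLen.1 this).false) hn
  have hN' : mu.rowLen 0 ≤ N := le_trans (by
    by_contra! h
    have := hmu (YoungDiagram.mem_iff_lt_rowLen.2 h)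
    exact (YoungDiagram.mem_iff_lt_rowLen.1 this).false) hN
  -- This shift turns the number of a boundary step into a content: `λ_i - i` for row `i` and `j + 1
  -- - λ'_j` for column `j`, with indices from `0`.
  let s : ℤ := 1 - n
  let H : Matrix (Fin (n + N)) (Fin (n + N)) R :=
    Matrix.of fun p q => rowSumIco w A B (p + s) (q + s)
  let E : Matrix (Fin (n + N)) (Fin (n + N)) R :=
    Matrix.of fun p q => (-1) ^ (p + q : ℕ) * colSumIco w A B (p + s) (q + s)
  have hHE : H * E = 1 := by
    ext p q
    rw [Matrix.mul_apply, Matrix.one_apply]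
    exact rowSumIco_mul_colSumIco_sum w A B s _ p q
  have hH : H.det = 1 := by
    rw [Matrix.det_of_isUpperTriangular]
    · simp [H, rowSumIco_self]
    · intro p q hpq
      have := Fin.lt_def.1 hpq
      simp only [H, Matrix.of_apply, rowSumIco]
      rw [if_pos (by simp at this; omega)]
  have key := Matrix.det_submatrix_eq_of_mul_eq_one hHE hH (boundaryPerm hn' hN')
    (boundaryPerm hn hN)
  have h1 : (H.submatrix (boundaryPerm hn' hN' ∘ Fin.castAdd N) (boundaryPerm hn hN ∘ Fin.castAdd N))
      = (Matrix.of fun i j : Fin n => rowSumIco w A B (mu.rowLen j - (j : ℕ))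
      (lam.rowLen i - (i : ℕ))).transpose := by
    ext i j
    simp only [H, s, Matrix.submatrix_apply, Matrix.of_apply, Matrix.transpose_apply,
      Function.comp_apply, boundaryPerm_apply, boundaryStep_castAdd]
    congr 1 <;> omega
  have h2 : (E.submatrix (boundaryPerm hn hN ∘ Fin.natAdd n) (boundaryPerm hn' hN' ∘ Fin.natAdd n))
      = Matrix.of fun i j : Fin N => (-1) ^ (boundaryPerm hn hN (Fin.natAdd n i) : ℕ) *
        (Matrix.of fun i j : Fin N => (-1) ^ (boundaryPerm hn' hN' (Fin.natAdd n j) : ℕ) *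
          (Matrix.of fun i j : Fin N => colSumIco w A B ((i : ℕ) + 1 - lam.colLen i)
      ((j : ℕ) + 1 - mu.colLen j)) i j) i j := by
    ext i j
    have := lam.colLen_anti 0 i (Nat.zero_le _)
    have := mu.colLen_anti 0 j (Nat.zero_le _)
    simp only [E, s, Matrix.submatrix_apply, Matrix.of_apply, pow_add,
      Function.comp_apply, boundaryPerm_apply, boundaryStep_natAdd, mul_assoc]
    congr 3 <;> omega
  rw [h1, h2, Matrix.det_transpose, Matrix.det_mul_column, Matrix.det_mul_row] at key
  rw [key, ← mul_assoc, ← mul_assoc]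
  -- The sign identities of `lam` and `mu` have the same right-hand side, so the product of their
  -- left-hand sides is `1`; this is the total sign in `key`.
  have hs (u : ℤˣ) : u * u = 1 := Int.units_mul_self u
  have h3 := congrArg₂ (· * ·) (sign_boundaryPerm_mul_prod hn hN)
    (sign_boundaryPerm_mul_prod hn' hN')
  simp only [hs] at h3
  have h4 := congrArg (fun u : ℤˣ => ((u : ℤ) : R)) h3
  simp only [Units.val_mul, Units.coe_prod, Units.val_pow_eq_pow_val, Units.val_neg,
    Units.val_one, Int.cast_mul, Int.cast_prod, Int.cast_pow, Int.cast_neg, Int.cast_one] at h4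
  rw [eq_comm, Units.val_mul, Int.cast_mul]
  convert one_mul _ using 2
  refine Eq.trans ?_ h4
  ring

end DualDeterminants

/-! ### Irrelevant entries of a determinant. -/

section DeterminantCongr

variable {R : Type*} [CommRing R]

/-- If the entry `(i, j)` of a matrix belongs to the interval `[α j, β i)`, then the entries whose
intervals are not covered by the intervals `[α l, β l)` do not matter for the determinant. -/
theorem Matrix.det_congr_of_covered {n : ℕ} {α β : Fin n → ℤ} {M M' : Matrix (Fin n) (Fin n) R} (h0 : ∀ i j, β i < α j → M i j = 0 ∧ M' i j = 0)
    (h1 : ∀ i j, α j ≤ β i → (∀ c, α j ≤ c → c < β i → ∃ l, α l ≤ c ∧ c < β l) →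
      M i j = M' i j) : M.det = M'.det := by
  rw [Matrix.det_apply, Matrix.det_apply]
  refine sum_congr rfl fun σ _ => ?_
  congr 1
  by_cases h : ∃ i, β (σ i) < α i
  · obtain ⟨i, hi⟩ := h
    rw [prod_eq_zero (f := fun i => M (σ i) i) (mem_univ i) (h0 _ _ hi).1,
      prod_eq_zero (f := fun i => M' (σ i) i) (mem_univ i) (h0 _ _ hi).2]
  · push Not at h
    refine prod_congr rfl fun i _ => h1 _ _ (h i) fun c hc hc' => ?_
    -- If `c` is not covered, then `α j ≤ c` implies `β j ≤ c`. As all factors have `α j ≤ β (σ j)`,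
    -- the inverse of `σ` preserves `{j | α j ≤ c}`, and by finiteness so does `σ`; this contradicts
    -- `c < β (σ i)`.
    by_contra! hl
    have hT : (univ.filter fun j => α j ≤ c).image σ.symm = univ.filter fun j => α j ≤ c := by
      refine eq_of_subset_of_card_le (image_subset_iff.2 fun j hj => ?_)
        (card_image_of_injective _ σ.symm.injective).ge
      rw [mem_filter] at hj ⊢
      have h2 := h (σ.symm j)
      rw [Equiv.apply_symm_apply] at h2
      exact ⟨mem_univ _, h2.trans (hl j hj.2)⟩
    obtain ⟨j, hj, rfl⟩ := mem_image.1 (hT.ge (mem_filter.2 ⟨mem_univ i, hc⟩))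
    rw [Equiv.apply_symm_apply] at hc'
    exact absurd (hl _ (mem_filter.1 hj).2) (not_le.2 hc')

end DeterminantCongr

/-! ### Bounds induced by flags at each content, and one-row shapes. -/

namespace RShape

variable (sh : RShape)

theorem mem_cells_iff (x : ℕ × ℕ) :
    x ∈ sh.cells ↔ sh.inner.colLen x.2 ≤ x.1 ∧ x.1 < sh.outer.colLen x.2 := by
  obtain ⟨i, j⟩ := x
  rw [cells, mem_sdiff, YoungDiagram.mem_cells, YoungDiagram.mem_cells,
    YoungDiagram.mem_iff_lt_colLen, YoungDiagram.mem_iff_lt_colLen, not_lt, and_comm]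

theorem mem_cells_iff_rowLen (x : ℕ × ℕ) :
    x ∈ sh.cells ↔ sh.inner.rowLen x.1 ≤ x.2 ∧ x.2 < sh.outer.rowLen x.1 := by
  obtain ⟨i, j⟩ := x
  rw [cells, mem_sdiff, YoungDiagram.mem_cells, YoungDiagram.mem_cells,
    YoungDiagram.mem_iff_lt_rowLen, YoungDiagram.mem_iff_lt_rowLen, not_lt, and_comm]

/-- The difference between the content of a position and its content `j - i` in the usual shape. -/
def shift : ℤ := sh.root - 1 + sh.outer.colLen 0

theorem content_eq (i j : ℤ) : sh.content i j = j - i + sh.shift := by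
  rw [content, shift]
  ring

theorem shift_usual (lam mu : YoungDiagram) (h : mu ≤ lam) : (usual lam mu h).shift = 0 := by
  simp [shift, usual]

/-- The content `c` occurs in the diagram. -/
def HasContent (c : ℤ) : Prop := ∃ x ∈ sh.cells, sh.content x.1 x.2 = c

variable {sh}

theorem HasContent.exists_isLeftmost {c : ℤ} (h : sh.HasContent c) : ∃ m, sh.IsLeftmost c m := by
  classical
  obtain ⟨x, hx, hc⟩ := h
  obtain ⟨m, hm, hm'⟩ := exists_min_image
    (sh.cells.filter fun x => sh.content x.1 x.2 = c) (fun x => x.2) ⟨x, mem_filter.2 ⟨hx, hc⟩⟩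
  rw [mem_filter] at hm
  exact ⟨m, hm.1, hm.2, fun x hx hc => hm' x (mem_filter.2 ⟨hx, hc⟩)⟩

theorem HasContent.exists_isRightmost {c : ℤ} (h : sh.HasContent c) :
    ∃ m, sh.IsRightmost c m := by
  classical
  obtain ⟨x, hx, hc⟩ := h
  obtain ⟨m, hm, hm'⟩ := exists_max_image
    (sh.cells.filter fun x => sh.content x.1 x.2 = c) (fun x => x.2) ⟨x, mem_filter.2 ⟨hx, hc⟩⟩
  rw [mem_filter] at hm
  exact ⟨m, hm.1, hm.2, fun x hx hc => hm' x (mem_filter.2 ⟨hx, hc⟩)⟩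

theorem IsLeftmost.unique {c : ℤ} {m m' : ℕ × ℕ} (h : sh.IsLeftmost c m)
    (h' : sh.IsLeftmost c m') : m = m' := by
  have h1 := h.2.1
  have h2 := h'.2.1
  have h3 := h.2.2 m' h'.1 h2
  have h4 := h'.2.2 m h.1 h1
  rw [content_eq] at h1 h2
  ext <;> omega

theorem IsRightmost.unique {c : ℤ} {m m' : ℕ × ℕ} (h : sh.IsRightmost c m)
    (h' : sh.IsRightmost c m') : m = m' := by
  have h1 := h.2.1
  have h2 := h'.2.1
  have h3 := h.2.2 m' h'.1 h2
  have h4 := h'.2.2 m h.1 h1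
  rw [content_eq] at h1 h2
  ext <;> omega

variable (sh) in
open Classical in
/-- The lower bound induced by the flag `a` on the entries of the cells of content `c`. -/
noncomputable def lowerBoundAt (a : ℕ → ℤ) (c : ℤ) : ℤ :=
  if h : ∃ m, sh.IsLeftmost c m then
    a h.choose.2 - ((sh.inner.colLen h.choose.2 : ℤ) + 1) + ((h.choose.1 : ℤ) + 1)
  else 0

variable (sh) in
open Classical in
/-- The upper bound induced by the flag `b` on the entries of the cells of content `c`. -/
noncomputable def upperBoundAt (b : ℕ → ℤ) (c : ℤ) : ℤ :=
  if h : ∃ m, sh.IsRightmost c m then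
    b h.choose.2 - (sh.outer.colLen h.choose.2 : ℤ) + ((h.choose.1 : ℤ) + 1)
  else 0

theorem IsLeftmost.lowerBoundAt_eq {c : ℤ} {m : ℕ × ℕ} (h : sh.IsLeftmost c m) (a : ℕ → ℤ) :
    sh.lowerBoundAt a c = a m.2 - ((sh.inner.colLen m.2 : ℤ) + 1) + ((m.1 : ℤ) + 1) := by
  have h' : ∃ m, sh.IsLeftmost c m := ⟨m, h⟩
  rw [lowerBoundAt, dif_pos h', h'.choose_spec.unique h]

theorem IsRightmost.upperBoundAt_eq {c : ℤ} {m : ℕ × ℕ} (h : sh.IsRightmost c m) (b : ℕ → ℤ) :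
    sh.upperBoundAt b c = b m.2 - (sh.outer.colLen m.2 : ℤ) + ((m.1 : ℤ) + 1) := by
  have h' : ∃ m, sh.IsRightmost c m := ⟨m, h⟩
  rw [upperBoundAt, dif_pos h', h'.choose_spec.unique h]

theorem IsInducedRowFlags.eq_boundAt {a b : ℕ → ℤ} {k : ℕ} {c : ℤ} {A B : ℕ → ℤ}
    (h : sh.IsInducedRowFlags a b k c A B) {r : ℕ} (hr : r < k) (hc : sh.HasContent (c + r)) :
    A r = sh.lowerBoundAt a (c + r) ∧ B r = sh.upperBoundAt b (c + r) := by
  obtain ⟨m, hm⟩ := hc.exists_isLeftmost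
  obtain ⟨M, hM⟩ := hc.exists_isRightmost
  rw [hm.lowerBoundAt_eq, hM.upperBoundAt_eq]
  exact ⟨(h r hr).1 m hm, (h r hr).2 M hM⟩

/-- Provides the hypothesis of the flag inequalities at every step from the column of `x` to that of
`x'`: since `x'` is further right with content only one larger, it is not in a higher row than `x`.
-/
theorem inner_colLen_lt_outer_colLen_succ {c : ℤ} {x x' : ℕ × ℕ} (hx : x ∈ sh.cells)
    (hx' : x' ∈ sh.cells) (hc : sh.content x.1 x.2 = c) (hc' : sh.content x'.1 x'.2 = c + 1)
    {i : ℕ} (hi : x.2 ≤ i) (hi' : i < x'.2) : sh.inner.colLen i < sh.outer.colLen (i + 1) := by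
  rw [mem_cells_iff] at hx hx'
  rw [content_eq] at hc hc'
  have h1 := sh.inner.colLen_anti _ _ hi
  have h2 := sh.outer.colLen_anti (i + 1) x'.2 hi'
  omega

theorem le_of_forall_le_succ {g : ℕ → ℤ} {p q : ℕ} (hpq : p ≤ q)
    (h : ∀ i, p ≤ i → i < q → g i ≤ g (i + 1)) : g p ≤ g q := by
  induction q, hpq using Nat.le_induction with
  | base => exact le_rfl
  | succ q hq ih =>
    exact (ih fun i hi hi' => h i hi (by omega)).trans (h q hq (by omega))

theorem IsColumnFlags.lowerBoundAt_le {a b : ℕ → ℤ} (hab : sh.IsColumnFlags a b) {c : ℤ}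
    (h : sh.HasContent c) (h' : sh.HasContent (c + 1)) :
    sh.lowerBoundAt a c ≤ sh.lowerBoundAt a (c + 1) + 1 := by
  obtain ⟨x, hx⟩ := h.exists_isLeftmost
  obtain ⟨x', hx'⟩ := h'.exists_isLeftmost
  have hc := hx.2.1
  have hc' := hx'.2.1
  have hle : x.2 ≤ x'.2 := by
    -- Otherwise the position below `x'` is a cell of content `c` to the left of `x`.
    by_contra! hlt
    have h1 := (sh.mem_cells_iff x).1 hx.1
    have h2 := (sh.mem_cells_iff x').1 hx'.1
    have h3 := sh.outer.colLen_anti _ _ hlt.le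
    rw [content_eq] at hc hc'
    have h4 := hx.2.2 (x'.1 + 1, x'.2) ((sh.mem_cells_iff _).2 ⟨by dsimp only; omega,
      by dsimp only; omega⟩) (by rw [content_eq]; push_cast; omega)
    dsimp only at h4
    omega
  -- The bound at a content is this function at the column of the leftmost cell, minus the content,
  -- up to a constant; the flag inequalities say that the function weakly increases.
  have hg := le_of_forall_le_succ (g := fun i => a i - sh.inner.colLen i + i) hle
    fun i hi hi' => by
      have := (hab i (inner_colLen_lt_outer_colLen_succ hx.1 hx'.1 hc hc' hi hi')).1
      push_cast
      omega
  rw [content_eq] at hc hc'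
  rw [hx.lowerBoundAt_eq, hx'.lowerBoundAt_eq]
  omega

theorem IsColumnFlags.upperBoundAt_le {a b : ℕ → ℤ} (hab : sh.IsColumnFlags a b) {c : ℤ}
    (h : sh.HasContent c) (h' : sh.HasContent (c + 1)) :
    sh.upperBoundAt b c ≤ sh.upperBoundAt b (c + 1) + 1 := by
  obtain ⟨x, hx⟩ := h.exists_isRightmost
  obtain ⟨x', hx'⟩ := h'.exists_isRightmost
  have hc := hx.2.1
  have hc' := hx'.2.1
  have hle : x.2 ≤ x'.2 := by
    -- Otherwise the position above `x` is a cell of content `c + 1` to the right of `x'`.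
    by_contra! hlt
    have h1 := (sh.mem_cells_iff x).1 hx.1
    have h2 := (sh.mem_cells_iff x').1 hx'.1
    have h3 := sh.inner.colLen_anti _ _ hlt.le
    rw [content_eq] at hc hc'
    have h4 := hx'.2.2 (x.1 - 1, x.2) ((sh.mem_cells_iff _).2 ⟨by dsimp only; omega,
      by dsimp only; omega⟩) (by rw [content_eq]; dsimp only; omega)
    dsimp only at h4
    omega
  have hg := le_of_forall_le_succ (g := fun i => b i - sh.outer.colLen i + i) hle
    fun i hi hi' => by
      have := (hab i (inner_colLen_lt_outer_colLen_succ hx.1 hx'.1 hc hc' hi hi')).2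
      push_cast
      omega
  rw [content_eq] at hc hc'
  rw [hx.upperBoundAt_eq, hx'.upperBoundAt_eq]
  omega

/-- Going up and left from the top position of column `j` stays inside `μ`. It is therefore
leftmost, and it is a cell as soon as its content occurs, even though column `j` is not assumed
nonempty. -/
theorem isLeftmost_top {j : ℕ} {c : ℤ} (hc : c = sh.content (sh.inner.colLen j) j)
    (h : sh.HasContent c) : sh.IsLeftmost c (sh.inner.colLen j, j) := by
  have hmin : ∀ x ∈ sh.cells, sh.content x.1 x.2 = c → j ≤ x.2 := by
    intro x hx hxc
    by_contra! hlt
    have h1 := (sh.mem_cells_iff x).1 hx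
    have h2 := sh.inner.colLen_anti _ _ hlt.le
    rw [content_eq] at hc hxc
    omega
  obtain ⟨x, hx, hxc⟩ := h
  have h1 := (sh.mem_cells_iff x).1 hx
  have h2 := hmin x hx hxc
  have h3 := sh.outer.colLen_anti _ _ h2
  refine ⟨(sh.mem_cells_iff _).2 ⟨le_rfl, ?_⟩, hc.symm, hmin⟩
  rw [content_eq] at hc hxc
  dsimp only
  omega

theorem isRightmost_bottom {j : ℕ} {c : ℤ} (hc : c = sh.content ((sh.outer.colLen j : ℤ) - 1) j)
    (h : sh.HasContent c) : 0 < sh.outer.colLen j ∧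
      sh.IsRightmost c (sh.outer.colLen j - 1, j) := by
  have hmax : ∀ x ∈ sh.cells, sh.content x.1 x.2 = c → x.2 ≤ j := by
    intro x hx hxc
    by_contra! hlt
    have h1 := (sh.mem_cells_iff x).1 hx
    have h2 := sh.outer.colLen_anti _ _ hlt.le
    rw [content_eq] at hc hxc
    omega
  obtain ⟨x, hx, hxc⟩ := h
  have h1 := (sh.mem_cells_iff x).1 hx
  have h2 := hmax x hx hxc
  have h3 := sh.inner.colLen_anti _ _ h2
  have hc' := hc
  rw [content_eq] at hc hxc
  have hpos : 0 < sh.outer.colLen j := by omega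
  refine ⟨hpos, (sh.mem_cells_iff _).2 ⟨by dsimp only; omega, by dsimp only; omega⟩, ?_, hmax⟩
  rw [hc']
  congr 1
  dsimp only
  omega

variable {R : Type*} [CommRing R] (y z : ℤ → R)

/-- The contents run from the bottom of column `i` to the top of column `j`. These positions are
rightmost and leftmost for their contents, so the induced bounds there are `b i` and `a j`. -/
theorem IsColumnFlags.superElem_eq_colSumIco {a b : ℕ → ℤ} (hab : sh.IsColumnFlags a b) {i j : ℕ}
    (hij : (i : ℤ) + 1 - sh.outer.colLen i ≤ j + 1 - sh.inner.colLen j)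
    (hocc : ∀ c : ℤ, (i : ℤ) + 1 - sh.outer.colLen i ≤ c → c < j + 1 - sh.inner.colLen j →
      sh.HasContent (c + sh.shift)) :
    superElem y z (Icc (a j) (b i)) (Icc (sh.conjLower a j) (sh.conjUpper b i))
      ((sh.outer.colLen i : ℤ) - (i : ℕ) - sh.inner.colLen j + (j : ℕ)) =
    colSumIco (fun c u => y u - z (u + (c + sh.shift))) (fun c => sh.lowerBoundAt a (c + sh.shift))
      (fun c => sh.upperBoundAt b (c + sh.shift)) ((i : ℤ) + 1 - sh.outer.colLen i)
      (j + 1 - sh.inner.colLen j) := by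
  rcases hij.eq_or_lt with h | h
  · rw [show (sh.outer.colLen i : ℤ) - (i : ℕ) - sh.inner.colLen j + (j : ℕ) = 0 by omega,
      superElem_zero, ← h, colSumIco_self]
  · obtain ⟨m, hm⟩ : ∃ m : ℕ, (j : ℤ) + 1 - sh.inner.colLen j =
        (i : ℤ) + 1 - sh.outer.colLen i + (m + 1 : ℕ) :=
      ⟨((j : ℤ) + 1 - sh.inner.colLen j - ((i : ℤ) + 1 - sh.outer.colLen i) - 1).toNat, by omega⟩
    set d : ℤ := (i : ℤ) + 1 - sh.outer.colLen i with hd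
    have hstep (r : ℕ) (hr : r < m) : sh.HasContent (d + r + sh.shift) ∧
        sh.HasContent (d + r + sh.shift + 1) := by
      refine ⟨hocc _ (by omega) (by omega), ?_⟩
      have := hocc (d + r + 1) (by omega) (by omega)
      rwa [add_right_comm] at this
    rw [hm, colSumIco, if_neg (by omega), show (d + (m + 1 : ℕ) - d).toNat = m + 1 by omega,
      colSum_eq_superElem]
    · have hA : sh.lowerBoundAt a (d + m + sh.shift) = a j := by
        rw [(isLeftmost_top (j := j) (by rw [content_eq]; omega)
          (hocc (d + m) (by omega) (by omega))).lowerBoundAt_eq]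
        ring
      have hB : sh.upperBoundAt b (d + sh.shift) = b i := by
        have h1 := isRightmost_bottom (j := i) (c := d + sh.shift) (by rw [content_eq]; omega)
          (hocc d le_rfl (by omega))
        rw [h1.2.upperBoundAt_eq]
        dsimp only
        omega
      rw [hA, hB, conjLower, conjUpper, content_eq, content_eq]
      congr 1
      · congr 1 <;> omega
      · omega
    · intro r hr
      have := hab.lowerBoundAt_le (hstep r hr).1 (hstep r hr).2
      rwa [add_right_comm _ _ 1] at this
    · intro r hr
      have := hab.upperBoundAt_le (hstep r hr).1 (hstep r hr).2
      rwa [add_right_comm _ _ 1] at this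

theorem IsColumnFlags.flaggedSchur_eq_det_rowSumIco {a b : ℕ → ℤ} (hab : sh.IsColumnFlags a b)
    {n N : ℕ} (hn : sh.outer.colLen 0 ≤ n) (hN : sh.outer.rowLen 0 ≤ N) :
    sh.flaggedSchur N a b y z = (Matrix.of fun i j : Fin n =>
      rowSumIco (fun c u => y u - z (u + (c + sh.shift)))
        (fun c => sh.lowerBoundAt a (c + sh.shift)) (fun c => sh.upperBoundAt b (c + sh.shift))
        (sh.inner.rowLen j - (j : ℕ)) (sh.outer.rowLen i - (i : ℕ))).det := by
  -- The transposition puts the left ends of the content intervals on the columns. The diagonal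
  -- intervals are then the content sets of the columns of the shape, so a covered content occurs in
  -- it.
  rw [← det_colSumIco_eq_det_rowSumIco _ _ _ sh.inner_le hn hN, flaggedSchur,
    ← Matrix.det_transpose, ← Matrix.det_transpose (Matrix.of _)]
  refine Matrix.det_congr_of_covered (α := fun i => (i : ℕ) + 1 - sh.outer.colLen i)
    (β := fun j => (j : ℕ) + 1 - sh.inner.colLen j) ?_ ?_
  · intro j i h
    exact ⟨superElem_of_neg _ _ _ _ (by omega), if_pos h⟩
  · intro j i h hocc
    refine hab.superElem_eq_colSumIco y z h fun c hc hc' => ?_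
    obtain ⟨l, hl, hl'⟩ := hocc c hc hc'
    refine ⟨((l - c : ℤ).toNat, l), (sh.mem_cells_iff _).2 ⟨?_, ?_⟩, ?_⟩
    · dsimp only
      omega
    · dsimp only
      omega
    · rw [content_eq]
      dsimp only
      omega

theorem row_inner_colLen (k : ℕ) (c : ℤ) (j : ℕ) : (row k c).inner.colLen j = 0 := by
  by_contra h
  exact YoungDiagram.notMem_bot _ (YoungDiagram.mem_iff_lt_colLen.2 (Nat.pos_of_ne_zero h))

theorem mem_row_outer {k : ℕ} {c : ℤ} {i j : ℕ} : (i, j) ∈ (row k c).outer ↔ i = 0 ∧ j < k := by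
  rw [row, YoungDiagram.mem_ofRowLens]
  constructor
  · rintro ⟨h, h'⟩
    have h0 : i = 0 := by simpa using h
    subst h0
    exact ⟨rfl, h'⟩
  · rintro ⟨rfl, h⟩
    exact ⟨by simp, h⟩

theorem lt_row_outer_colLen {k : ℕ} {c : ℤ} {i j : ℕ} :
    i < (row k c).outer.colLen j ↔ i = 0 ∧ j < k := by
  rw [← YoungDiagram.mem_iff_lt_colLen, mem_row_outer]

theorem row_outer_colLen {k : ℕ} (c : ℤ) {j : ℕ} (hj : j < k) :
    (row k c).outer.colLen j = 1 := by
  have h1 : 0 < (row k c).outer.colLen j := lt_row_outer_colLen.2 ⟨rfl, hj⟩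
  have h2 : ¬ 1 < (row k c).outer.colLen j := fun h => by
    simpa using (lt_row_outer_colLen.1 h).1
  omega

theorem row_outer_rowLen_zero (k : ℕ) (c : ℤ) : (row k c).outer.rowLen 0 = k := by
  have h (j : ℕ) : j < (row k c).outer.rowLen 0 ↔ j < k := by
    rw [← YoungDiagram.mem_iff_lt_rowLen, mem_row_outer]
    simp
  have h1 := h k
  have h2 := h ((row k c).outer.rowLen 0)
  omega

theorem row_inner_rowLen_zero (k : ℕ) (c : ℤ) : (row k c).inner.rowLen 0 = 0 := by
  by_contra h
  exact YoungDiagram.notMem_bot _ (YoungDiagram.mem_iff_lt_rowLen.2 (Nat.pos_of_ne_zero h))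

theorem isColumnFlags_row_iff {k : ℕ} {c : ℤ} {p q : ℕ → ℤ} : (row k c).IsColumnFlags p q ↔
    ∀ i, i + 1 < k → p i ≤ p (i + 1) + 1 ∧ q i ≤ q (i + 1) + 1 := by
  constructor
  · intro h i hi
    have := h i (by rw [row_inner_colLen, lt_row_outer_colLen]; exact ⟨rfl, hi⟩)
    rw [row_inner_colLen, row_inner_colLen, row_outer_colLen c hi,
      row_outer_colLen c (show i < k by omega)] at this
    omega
  · intro h i hi
    rw [row_inner_colLen, lt_row_outer_colLen] at hi
    have := h i hi.2
    rw [row_inner_colLen, row_inner_colLen, row_outer_colLen c hi.2,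
      row_outer_colLen c (show i < k by omega)]
    omega

end RShape

/-! ### Tableau expansion for one row. -/

section RowExpansion

variable {R : Type*} [CommRing R] (y z : ℤ → R)

theorem rowTableauSum_eq_rowSum {k : ℕ} {c c' s : ℤ} {p q : ℕ → ℤ} {A B : ℤ → ℤ}
    (hc : 0 < k → c = c' + s) (hA : ∀ r < k, p r = A (c' + r)) (hB : ∀ r < k, q r = B (c' + r)) :
    rowTableauSum k c p q y z = rowSum (fun c u => y u - z (u + (c + s))) A B c' k := by
  rw [← sum_monotone_eq_rowSum, rowTableauSum]
  simp only [hA _ (Fin.is_lt _), hB _ (Fin.is_lt _)]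
  refine sum_congr rfl fun f _ => prod_congr rfl fun r _ => ?_
  rw [hc (by have := r.is_lt; omega)]
  congr 2
  ring

theorem flaggedComplete_eq_rowTableauSum {k : ℕ} {c : ℤ} {p q : ℕ → ℤ}
    (h : (RShape.row k c).IsColumnFlags p q) :
    flaggedComplete k c p q y z = rowTableauSum k c p q y z := by
  have hn : (RShape.row k c).outer.colLen 0 ≤ 1 := by
    by_contra! h
    simpa using (RShape.lt_row_outer_colLen.1 h).1
  rw [flaggedComplete, if_neg (by omega), Int.toNat_natCast,
    h.flaggedSchur_eq_det_rowSumIco y z hn (RShape.row_outer_rowLen_zero k c).le,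
    Matrix.det_fin_one, Matrix.of_apply, rowSumIco]
  simp only [Fin.val_zero, RShape.row_outer_rowLen_zero, RShape.row_inner_rowLen_zero]
  rw [if_neg (by omega)]
  -- For `k = 0` the first column is empty and the shift is `c - 1`, which is harmless because the
  -- sum then involves no weight.
  have hshift (hk : 0 < k) : (RShape.row k c).shift = c := by
    rw [RShape.shift, RShape.row_outer_colLen c hk]
    simp [RShape.row]
  have hcell (r : ℕ) (hr : r < k) : (0, r) ∈ (RShape.row k c).cells := by
    rw [RShape.mem_cells_iff, RShape.row_inner_colLen, RShape.row_outer_colLen c hr]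
    simp
  have huniq (r : ℕ) (x : ℕ × ℕ) (hx : x ∈ (RShape.row k c).cells)
      (hc : (RShape.row k c).content x.1 x.2 = r + (RShape.row k c).shift) : x.2 = r := by
    rw [RShape.mem_cells_iff, RShape.lt_row_outer_colLen] at hx
    rw [RShape.content_eq] at hc
    omega
  simp only [Nat.cast_zero, sub_zero, Int.toNat_natCast]
  symm
  refine rowTableauSum_eq_rowSum y z (fun hk => by rw [hshift hk, zero_add]) ?_ ?_
  · intro r hr
    have hm : (RShape.row k c).IsLeftmost (0 + r + (RShape.row k c).shift) (0, r) :=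
      ⟨hcell r hr, by rw [RShape.content_eq]; simp, fun x hx hc =>
        (huniq r x hx (by rw [hc, zero_add])).ge⟩
    rw [hm.lowerBoundAt_eq, RShape.row_inner_colLen]
    simp
  · intro r hr
    have hm : (RShape.row k c).IsRightmost (0 + r + (RShape.row k c).shift) (0, r) :=
      ⟨hcell r hr, by rw [RShape.content_eq]; simp, fun x hx hc =>
        (huniq r x hx (by rw [hc, zero_add])).le⟩
    rw [hm.upperBoundAt_eq, RShape.row_outer_colLen c hr]
    simp

theorem RShape.IsColumnFlags.isColumnFlags_row {sh : RShape} {a b : ℕ → ℤ}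
    (hab : sh.IsColumnFlags a b) {k : ℕ} {c : ℤ} {A B : ℕ → ℤ}
    (hAB : sh.IsInducedRowFlags a b k c A B) (hocc : ∀ r < k, sh.HasContent (c + r)) :
    (RShape.row k c).IsColumnFlags A B := by
  rw [RShape.isColumnFlags_row_iff]
  intro i hi
  have h1 := hAB.eq_boundAt (show i < k by omega) (hocc i (by omega))
  have h2 := hAB.eq_boundAt hi (hocc _ hi)
  have h3 := hocc _ hi
  rw [Nat.cast_succ, ← add_assoc] at h2 h3
  rw [h1.1, h1.2, h2.1, h2.2]
  exact ⟨hab.lowerBoundAt_le (hocc i (by omega)) h3, hab.upperBoundAt_le (hocc i (by omega)) h3⟩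

end RowExpansion

/-! ### The Jacobi–Trudi-type formula. -/

theorem mainTheorem8 {R : Type*} [CommRing R] (y z : ℤ → R)
    (lam mu : YoungDiagram) (hmu : mu ≤ lam)
    (N : ℕ) (hN : lam.rowLen 0 ≤ N)
    (a b : ℕ → ℤ) (hab : (RShape.usual lam mu hmu).IsColumnFlags a b)
    (n : ℕ) (hn : lam.colLen 0 ≤ n)
    (len : Fin n → Fin n → ℤ)
    (hlen : ∀ i j : Fin n, len i j = (lam.rowLen i : ℤ) - mu.rowLen j - (i : ℕ) + (j : ℕ))
    (root : Fin n → ℤ) (hroot : ∀ j : Fin n, root j = (mu.rowLen j : ℤ) - (j : ℕ))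
    (A B : Fin n → Fin n → ℕ → ℤ)
    (hAB : ∀ i j : Fin n, (RShape.usual lam mu hmu).IsInducedRowFlags a b
      (len i j).toNat (root j) (A i j) (B i j)) :
    -- the Jacobi-Trudi-type determinant
    (RShape.usual lam mu hmu).flaggedSchur N a b y z =
      Matrix.det (Matrix.of fun i j : Fin n =>
        flaggedComplete (len i j) (root j) (A i j) (B i j) y z) ∧
    -- the entries whose contents all occur in the diagram
    (∀ i j : Fin n, 0 ≤ len i j →
      (∀ r < (len i j).toNat, ∃ x ∈ (RShape.usual lam mu hmu).cells,
        (RShape.usual lam mu hmu).content x.1 x.2 = root j + r) →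
      (RShape.row (len i j).toNat (root j)).IsColumnFlags (A i j) (B i j) ∧
      flaggedComplete (len i j) (root j) (A i j) (B i j) y z =
        rowTableauSum (len i j).toNat (root j) (A i j) (B i j) y z) ∧
    -- the tableau expansion of the functions `h` for arbitrary flags
    (∀ (k : ℕ) (c : ℤ) (p q : ℕ → ℤ), (RShape.row k c).IsColumnFlags p q →
      flaggedComplete k c p q y z = rowTableauSum k c p q y z) := by
  have hrow (i j : Fin n) (hl : 0 ≤ len i j)
      (hocc : ∀ r < (len i j).toNat, (RShape.usual lam mu hmu).HasContent (root j + r)) :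
      (RShape.row (len i j).toNat (root j)).IsColumnFlags (A i j) (B i j) ∧
      flaggedComplete (len i j) (root j) (A i j) (B i j) y z =
        rowTableauSum (len i j).toNat (root j) (A i j) (B i j) y z := by
    have hf := hab.isColumnFlags_row (hAB i j) hocc
    have := flaggedComplete_eq_rowTableauSum y z hf
    rw [Int.toNat_of_nonneg hl] at this
    exact ⟨hf, this⟩
  refine ⟨?_, hrow, fun k c p q h => flaggedComplete_eq_rowTableauSum y z h⟩
  rw [hab.flaggedSchur_eq_det_rowSumIco y z hn hN]
  -- The diagonal intervals are now the content sets of the rows, so the covered entries are those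
  -- with all contents in `λ/μ`; for these the induced flags are genuine flags.
  refine Matrix.det_congr_of_covered (α := fun j => mu.rowLen j - (j : ℕ))
    (β := fun i => lam.rowLen i - (i : ℕ)) ?_ ?_
  · intro i j h
    exact ⟨if_pos h, if_pos (by rw [hlen]; omega)⟩
  · intro i j h hocc
    have hl : 0 ≤ len i j := by rw [hlen]; omega
    have hocc' (r : ℕ) (hr : r < (len i j).toNat) :
        (RShape.usual lam mu hmu).HasContent (root j + r) := by
      obtain ⟨l, hl1, hl2⟩ := hocc (root j + r) (by rw [hroot]; omega)
        (by rw [hroot]; have := hlen i j; omega)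
      refine ⟨(l, (root j + r + l).toNat), (RShape.mem_cells_iff_rowLen _ _).2 ⟨?_, ?_⟩, ?_⟩
      · change mu.rowLen l ≤ (root j + r + l).toNat
        omega
      · change (root j + r + l).toNat < lam.rowLen l
        omega
      · rw [RShape.content_eq, RShape.shift_usual]
        dsimp only
        omega
    rw [Matrix.of_apply, Matrix.of_apply, (hrow i j hl hocc').2]
    change rowSumIco _ _ _ (mu.rowLen j - (j : ℕ) : ℤ) (lam.rowLen i - (i : ℕ) : ℤ) = _
    rw [rowSumIco, if_neg (not_lt.2 h), ← hroot,
      show ((lam.rowLen i : ℤ) - (i : ℕ) - root j).toNat = (len i j).toNat by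
        rw [hlen, hroot]; congr 1; ring]
    symm
    refine rowTableauSum_eq_rowSum y z (fun _ => by rw [RShape.shift_usual, add_zero]) ?_ ?_
    · intro r hr
      rw [RShape.shift_usual, add_zero]
      exact ((hAB i j).eq_boundAt hr (hocc' r hr)).1
    · intro r hr
      rw [RShape.shift_usual, add_zero]
      exact ((hAB i j).eq_boundAt hr (hocc' r hr)).2
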